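/- Let $L_2=\mathbb{Z}_2\wr\mathbb{Z}$ be the lamplighter group, that is, the set of pairs $(\delta,f)$ with $\delta\in\mathbb{Z}$ and $f\in\mathbb{Z}_2[z^{\pm1}]$ a Laurent polynomial, with the multiplication $$(\delta_1,f_1)(\delta_2,f_2)=(\delta_1+\delta_2,\; f_1z^{-\delta_2}+f_2),$$ generated by $a=(0,1)$ and $t=(1,0)$. For a group word $w=w(a,t,x)$ in the letters $a^{\pm1},t^{\pm1},x^{\pm1}$, let $\sigma_x(w)\in\mathbb{Z}$ be the sum of the exponents of $x$ in $w$. The one-variable equation $w(a,t,x)=1$ over $L_2$ has a solution if $w(a,t,g)=1$ in $L_2$ for some $g\in L_2$. There exists an algorithm that, given a word $w=w(a,t,x)$ with $\sigma_x(w)=0$, decides whether the equation $w(a,t,x)=1$ has a solution in $L_2$. Moreover, the Diophantine problem $\mathbf{DP}_1(L_2)$ for one-variable equations over $L_2$ is decidable: there is an algorithm that, given an arbitrary group word $w=w(a,t,x)$, decides whether there is a group word $s=s(a,t)$ such that $w(a,t,s(a,t))=1$ in $L_2$. -/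

import Mathlib

open scoped LaurentPolynomial

/-- The lamplighter group `ℤ₂ ≀ ℤ = ℤ ⋉ ℤ₂[z^±]`: the element `(δ, f)` consists of the position `δ`
of the lamplighter and the finitely supported configuration `f : ℤ → ℤ₂` of lit lamps, written as
the Laurent polynomial `∑ i, f i * z ^ i`. -/
@[ext]
structure Lamplighter where
  pos : ℤ
  lamps : (ZMod 2)[T;T⁻¹]

namespace Lamplighter

/-- `(δ₁, f₁) (δ₂, f₂) = (δ₁ + δ₂, f₁ ^ δ₂ + f₂)`, where `f ^ δ = f * z ^ (-δ)` is the shift of `f`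
by `δ`, that is, `(f ^ δ) i = f (i + δ)`. -/
noncomputable instance : Mul Lamplighter :=
  ⟨fun g h => ⟨g.pos + h.pos, g.lamps * LaurentPolynomial.T (-h.pos) + h.lamps⟩⟩

noncomputable instance : One Lamplighter := ⟨⟨0, 0⟩⟩

/-- `(δ, f)⁻¹ = (-δ, -f ^ (-δ))`. -/
noncomputable instance : Inv Lamplighter :=
  ⟨fun g => ⟨-g.pos, -(g.lamps * LaurentPolynomial.T g.pos)⟩⟩

theorem mul_def (g h : Lamplighter) :
    g * h = ⟨g.pos + h.pos, g.lamps * LaurentPolynomial.T (-h.pos) + h.lamps⟩ := rfl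

theorem one_def : (1 : Lamplighter) = ⟨0, 0⟩ := rfl

theorem inv_def (g : Lamplighter) :
    g⁻¹ = ⟨-g.pos, -(g.lamps * LaurentPolynomial.T g.pos)⟩ := rfl

noncomputable instance : Group Lamplighter :=
  Group.ofLeftAxioms
    (by
      intro g h k
      simp only [mul_def, mk.injEq]
      refine ⟨by ring, ?_⟩
      rw [neg_add, LaurentPolynomial.T_add]
      ring)
    (by
      intro g
      simp [mul_def, one_def])
    (by
      intro g
      simp only [mul_def, inv_def, one_def, mk.injEq]
      refine ⟨by ring, ?_⟩
      rw [neg_mul, mul_assoc, ← LaurentPolynomial.T_add]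
      simp)

/-- The generator `a = (0, 𝟏₀)`: it switches the lamp at the origin. -/
noncomputable def a : Lamplighter := ⟨0, 1⟩

/-- The generator `t = (1, 0)`: it moves the lamplighter by one step. -/
noncomputable def t : Lamplighter := ⟨1, 0⟩

end Lamplighter

/-- Group words `w(a, t, x)` as finite strings of letters: `0, 1, 2 : Fin 3` stand for `a, t, x`,
and the letter `(i, true)` is the `i`-th generator, `(i, false)` its inverse. The string `w`
represents the element `FreeGroup.mk w` of the free group `F(a, t, x)`. -/
abbrev Word : Type := List (Fin 3 × Bool)

/-- `σ_x(w)`, the sum of the exponents of `x` in `w`. -/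
def sigmaX (w : Word) : ℤ :=
  (w.map fun l => if l.1 = 2 then (if l.2 then (1 : ℤ) else -1) else 0).sum

/-- The value in the lamplighter group of `w(a, t, x)` at `x = g`. -/
noncomputable def evalAt (w : Word) (g : Lamplighter) : Lamplighter :=
  FreeGroup.lift ![Lamplighter.a, Lamplighter.t, g] (FreeGroup.mk w)

/-- The equation `w(a, t, x) = 1` has a solution in the lamplighter group. -/
def HasSolution (w : Word) : Prop :=
  ∃ g : Lamplighter, evalAt w g = 1

/-- The question of the Diophantine problem `DP₁(L₂)` at the input `w`: is there a group word
`s = s(a, t)` with `w(a, t, s(a, t)) = 1` in the lamplighter group? -/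
def DP1 (w : Word) : Prop :=
  ∃ s : FreeGroup (Fin 2),
    evalAt w (FreeGroup.lift ![Lamplighter.a, Lamplighter.t] s) = 1

/-!
Evaluating a word `w(a, t, x)` of length `n` at `x = (δ, f)` gives the position `τ + σ δ`, with
`σ = σ_x(w)`, and lamps that are, up to a power of `z`, an affine function `P(z ^ δ) f + Q(z ^ δ)`
of `f`; here `P` and `Q` are polynomials in one variable `X` over `ℤ₂[z^±]`, with degrees and
exponents bounded in terms of `n` (`Lamplighter.exists_isWordMap_evalAt`). So `w = 1` is solvable
exactly when some integer `δ` with `τ + σ δ = 0` makes `P(z ^ δ)` divide `Q(z ^ δ)`.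

If `σ ≠ 0`, there is at most one such `δ`, of absolute value at most `n`. If `σ = 0`, the
parameter `δ` is free, and the point is that a solution `δ`, if there is one, can be chosen below
a computable bound (`LaurentPolynomial.exists_dvd_eval_T_natAbs_le`). By the automorphism
`z ↦ z⁻¹` one may take `δ ≥ 0`, and `P` may be assumed not to be divisible by `X`. Let `c` be the
leading coefficient of `P`. Pseudo-division gives `c ^ k Q = P S + R` with `deg R < deg P`. When
`δ` is large, the coefficients of `P` and `R` occupy disjoint blocks of exponents in `P(z ^ δ)`
and `R(z ^ δ)`, so that `R(z ^ δ)`, unless zero, is narrower than `P(z ^ δ)` and not divisible by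
it; hence `R = 0` (`LaurentPolynomial.pseudo_rem_eq_zero`). Then, for large `δ`, divisibility of
`Q(z ^ δ)` by `P(z ^ δ)` means that `c ^ k` divides `S(z ^ δ)`, and this is a periodic condition
on `δ`, since `z` has finite order modulo `c ^ k` (`LaurentPolynomial.exists_dvd_T_sub_one`).

Once `δ` is bounded, so are the exponents in the quotient `f`. A solvable equation therefore has a
solution in an explicit finite set (`Lamplighter.exists_bounded_solution`), which is searched by a
primitive recursive procedure on codes of group elements (`Lamplighter.Code.hasSolution_iff`).
Since `a` and `t` generate the group, solutions given by words in `a`, `t` are the same as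
solutions in the group (`Lamplighter.dp1_iff_hasSolution`).
-/

namespace LaurentPolynomial

/-! ### Supports of Laurent polynomials -/

section Support

variable {F : Type*} [Field F]

/-- The Laurent polynomial `f` only involves the monomials `T i` with `u ≤ i ≤ v`. -/
def SupportedIn (u v : ℤ) (f : F[T;T⁻¹]) : Prop :=
  ∀ i, f.coeff i ≠ 0 → u ≤ i ∧ i ≤ v

theorem supportedIn_zero (u v : ℤ) : SupportedIn u v (0 : F[T;T⁻¹]) := by
  intro i hi
  simp at hi

theorem SupportedIn.mono {u v u' v' : ℤ} {f : F[T;T⁻¹]} (h : SupportedIn u v f) (hu : u' ≤ u)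
    (hv : v ≤ v') : SupportedIn u' v' f := fun i hi => by
  have := h i hi
  omega

theorem SupportedIn.add {u v : ℤ} {f g : F[T;T⁻¹]} (hf : SupportedIn u v f)
    (hg : SupportedIn u v g) : SupportedIn u v (f + g) := fun i hi => by
  by_cases h : f.coeff i = 0
  · refine hg i fun h' => hi ?_
    simp [h, h']
  · exact hf i h

theorem SupportedIn.neg {u v : ℤ} {f : F[T;T⁻¹]} (hf : SupportedIn u v f) :
    SupportedIn u v (-f) := fun i hi => hf i (by simpa using hi)

theorem SupportedIn.sub {u v : ℤ} {f g : F[T;T⁻¹]} (hf : SupportedIn u v f)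
    (hg : SupportedIn u v g) : SupportedIn u v (f - g) := by
  rw [sub_eq_add_neg]
  exact hf.add hg.neg

theorem SupportedIn.sum {ι : Type*} {u v : ℤ} (s : Finset ι) {f : ι → F[T;T⁻¹]}
    (h : ∀ i ∈ s, SupportedIn u v (f i)) : SupportedIn u v (∑ i ∈ s, f i) :=
  Finset.sum_induction f (SupportedIn u v) (fun _ _ => SupportedIn.add) (supportedIn_zero u v) h

theorem SupportedIn.mul {u v u' v' : ℤ} {f g : F[T;T⁻¹]} (hf : SupportedIn u v f)
    (hg : SupportedIn u' v' g) : SupportedIn (u + u') (v + v') (f * g) := by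
  classical
  intro i hi
  have h := AddMonoidAlgebra.support_coeff_mul_subset f g (Finsupp.mem_support_iff.2 hi)
  obtain ⟨j, hj, k, hk, rfl⟩ := Finset.mem_add.1 h
  have h1 := hf j (Finsupp.mem_support_iff.1 hj)
  have h2 := hg k (Finsupp.mem_support_iff.1 hk)
  omega

theorem coeff_mul_T (f : F[T;T⁻¹]) (n i : ℤ) : (f * T n).coeff i = f.coeff (i - n) := by
  have := AddMonoidAlgebra.coeff_mul_single_apply f (1 : F) n i
  rwa [mul_one, ← sub_eq_add_neg] at this

theorem coeff_T (n i : ℤ) : (T n : F[T;T⁻¹]).coeff i = if n = i then 1 else 0 :=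
  Finsupp.single_apply

theorem supportedIn_T (n : ℤ) : SupportedIn n n (T n : F[T;T⁻¹]) := fun i hi => by
  rw [coeff_T] at hi
  have : n = i := by
    by_contra h
    simp [h] at hi
  omega

theorem supportedIn_one : SupportedIn 0 0 (1 : F[T;T⁻¹]) := by
  rw [← T_zero]
  exact supportedIn_T 0

theorem coeff_toLaurent_natCast (p : Polynomial F) (n : ℕ) :
    p.toLaurent.coeff (n : ℤ) = p.coeff n := by
  rw [Polynomial.toLaurent_apply]
  exact Finsupp.mapDomain_apply Nat.cast_injective _ _

theorem SupportedIn.pow {D : ℤ} {f : F[T;T⁻¹]} (hf : SupportedIn (-D) D f) (k : ℕ) :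
    SupportedIn (-(k * D)) (k * D) (f ^ k) := by
  induction k with
  | zero => simpa using supportedIn_one
  | succ k ih =>
    rw [pow_succ]
    refine (ih.mul hf).mono ?_ ?_ <;> push_cast <;> linarith

theorem SupportedIn.invert {D : ℤ} {f : F[T;T⁻¹]} (hf : SupportedIn (-D) D f) :
    SupportedIn (-D) D (LaurentPolynomial.invert f) := fun i hi => by
  have := hf (-i) (by simpa using hi)
  omega

theorem exists_coeff_ne_zero {f : F[T;T⁻¹]} (hf : f ≠ 0) : ∃ i, f.coeff i ≠ 0 := by
  by_contra! h
  exact hf (LaurentPolynomial.ext (by simpa using h))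

/-- The leading monomial of a product is the product of the leading monomials. -/
theorem exists_le_coeff_mul_ne_zero {f g : F[T;T⁻¹]} {i j : ℤ} (hi : f.coeff i ≠ 0)
    (hj : g.coeff j ≠ 0) : ∃ k, i + j ≤ k ∧ (f * g).coeff k ≠ 0 := by
  classical
  have hf : f.coeff.support.Nonempty := ⟨i, Finsupp.mem_support_iff.2 hi⟩
  have hg : g.coeff.support.Nonempty := ⟨j, Finsupp.mem_support_iff.2 hj⟩
  have hmf := f.coeff.support.max'_mem hf
  have hmg := g.coeff.support.max'_mem hg
  have hle : ∀ m ∈ f.coeff.support, m ≤ f.coeff.support.max' hf := fun m hm =>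
    Finset.le_max' _ _ hm
  have hle' : ∀ m ∈ g.coeff.support, m ≤ g.coeff.support.max' hg := fun m hm =>
    Finset.le_max' _ _ hm
  have h1 := hle i (Finsupp.mem_support_iff.2 hi)
  have h2 := hle' j (Finsupp.mem_support_iff.2 hj)
  refine ⟨f.coeff.support.max' hf + g.coeff.support.max' hg, by omega, ?_⟩
  rw [AddMonoidAlgebra.coeff_mul_add_of_uniqueAdd]
  · exact mul_ne_zero (Finsupp.mem_support_iff.1 hmf) (Finsupp.mem_support_iff.1 hmg)
  · intro x y hx hy hxy
    have := hle x hx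
    have := hle' y hy
    omega

/-- The lowest monomial of a product is the product of the lowest monomials. -/
theorem exists_ge_coeff_mul_ne_zero {f g : F[T;T⁻¹]} {i j : ℤ} (hi : f.coeff i ≠ 0)
    (hj : g.coeff j ≠ 0) : ∃ k, k ≤ i + j ∧ (f * g).coeff k ≠ 0 := by
  obtain ⟨k, hk, h⟩ := exists_le_coeff_mul_ne_zero (f := invert f) (g := invert g)
    (i := -i) (j := -j) (by simpa using hi) (by simpa using hj)
  refine ⟨-k, by omega, ?_⟩
  rw [← map_mul] at h
  rwa [invert_apply] at h

/-- A nonzero multiple of `f` is at least as wide as `f`. -/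
theorem sub_le_of_mul_supportedIn {f g : F[T;T⁻¹]} {i j u v : ℤ} (hi : f.coeff i ≠ 0)
    (hj : f.coeff j ≠ 0) (hg : g ≠ 0) (h : SupportedIn u v (f * g)) : j - i ≤ v - u := by
  obtain ⟨m, hm⟩ := exists_coeff_ne_zero hg
  obtain ⟨k, hk, hk'⟩ := exists_le_coeff_mul_ne_zero hj hm
  obtain ⟨l, hl, hl'⟩ := exists_ge_coeff_mul_ne_zero hi hm
  have := h k hk'
  have := h l hl'
  omega

/-- If `f ≠ 0` then the exponents of a quotient `f * g / f` are bounded by those of `f` and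
`f * g`. -/
theorem supportedIn_of_mul {f g : F[T;T⁻¹]} {K : ℤ} (hf : f ≠ 0) (hK : SupportedIn (-K) K f)
    (h : SupportedIn (-K) K (f * g)) : SupportedIn (-(2 * K)) (2 * K) g := by
  intro j hj
  obtain ⟨i, hi⟩ := exists_coeff_ne_zero hf
  obtain ⟨k, hk, hk'⟩ := exists_le_coeff_mul_ne_zero hi hj
  obtain ⟨l, hl, hl'⟩ := exists_ge_coeff_mul_ne_zero hi hj
  have := h k hk'
  have := h l hl'
  have := hK i hi
  omega

end Support

/-! ### The order of `T` modulo a Laurent polynomial -/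

section Period

variable {F : Type*} [Field F]

/-- Modulo a nonzero Laurent polynomial over a finite field, `T` has finite multiplicative order:
the residues of its powers lie in a finite quotient ring. -/
theorem exists_dvd_T_sub_one [Fintype F] {c : F[T;T⁻¹]} {E : ℕ} (hc : c ≠ 0)
    (hE : SupportedIn (-(E : ℤ)) E c) :
    ∃ N : ℕ, 0 < N ∧ N ≤ Fintype.card F ^ (2 * E) ∧ c ∣ T (N : ℤ) - 1 := by
  classical
  -- Up to the unit `T E`, `c` is an ordinary polynomial of degree at most `2 * E`.
  obtain ⟨p, hp⟩ : ∃ p : Polynomial F, p.toLaurent = c * T (E : ℤ) := by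
    obtain ⟨n, p, hp⟩ := exists_T_pow (c * T (E : ℤ))
    have hdvd : Polynomial.X ^ n ∣ p := by
      rw [Polynomial.X_pow_dvd_iff]
      intro d hd
      have h1 : p.toLaurent.coeff d = p.coeff d := coeff_toLaurent_natCast p d
      rw [← h1, hp, coeff_mul_T, coeff_mul_T]
      by_contra h
      have := hE _ h
      omega
    obtain ⟨q, rfl⟩ := hdvd
    refine ⟨q, ?_⟩
    rw [map_mul, Polynomial.toLaurent_X_pow, T_mul] at hp
    exact (isUnit_T (n : ℤ)).mul_right_cancel hp
  have hcoeff : ∀ n : ℕ, p.coeff n = c.coeff (n - E) := fun n => by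
    rw [← coeff_mul_T, ← hp]
    exact (coeff_toLaurent_natCast p n).symm
  have hp0 : p ≠ 0 := by
    rintro rfl
    rw [map_zero] at hp
    exact mul_ne_zero hc (isUnit_T _).ne_zero hp.symm
  have hdeg : p.natDegree ≤ 2 * E := by
    rw [Polynomial.natDegree_le_iff_coeff_eq_zero]
    intro n hn
    rw [hcoeff]
    by_contra h
    have := hE _ h
    omega
  have hlt : ∀ i : ℕ, (Polynomial.X ^ i % p).degree < ((2 * E : ℕ) : WithBot ℕ) := fun i =>
    (EuclideanDomain.mod_lt (Polynomial.X ^ i) hp0).trans_le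
      ((Polynomial.natDegree_le_iff_degree_le.1 hdeg))
  -- There are more powers of `X` in this range than residues modulo `p`.
  let r : ℕ → (Fin (2 * E) → F) := fun i j => (Polynomial.X ^ i % p).coeff j
  obtain ⟨i, hi, j, hj, hij, hr⟩ := Finset.exists_ne_map_eq_of_card_lt_of_maps_to
    (s := Finset.range (Fintype.card F ^ (2 * E) + 1)) (t := Finset.univ) (f := r)
    (by simp) (fun _ _ => Finset.mem_coe.2 (Finset.mem_univ _))
  wlog hlt' : i < j generalizing i j
  · exact this j hj i hi hij.symm hr.symm (by omega)
  have hmod : Polynomial.X ^ i % p = Polynomial.X ^ j % p := by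
    ext m
    by_cases hm : m < 2 * E
    · exact congrFun hr ⟨m, hm⟩
    · have hm' : ((2 * E : ℕ) : WithBot ℕ) ≤ m := by exact_mod_cast not_lt.1 hm
      rw [Polynomial.coeff_eq_zero_of_degree_lt ((hlt i).trans_le hm'),
        Polynomial.coeff_eq_zero_of_degree_lt ((hlt j).trans_le hm')]
  have hdvd : p ∣ Polynomial.X ^ j - Polynomial.X ^ i :=
    (EuclideanDomain.mod_eq_zero).1 (by rw [Polynomial.sub_mod, hmod, sub_self])
  have hj' := Finset.mem_range.1 hj
  refine ⟨j - i, by omega, by omega, ?_⟩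
  have h := map_dvd Polynomial.toLaurent hdvd
  rw [hp, map_sub, Polynomial.toLaurent_X_pow, Polynomial.toLaurent_X_pow] at h
  have h' : (T (j : ℤ) - T (i : ℤ) : F[T;T⁻¹]) = (T ((j - i : ℕ) : ℤ) - 1) * T (i : ℤ) := by
    rw [sub_mul, ← T_add, one_mul]
    congr 2
    omega
  rw [h'] at h
  exact ((isUnit_T (i : ℤ)).dvd_mul_right).1 ((dvd_mul_right _ _).trans h)

end Period

end LaurentPolynomial

namespace LaurentPolynomial

/-! ### Divisibility after the substitution `X = T δ` -/

section Specialization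

variable {F : Type*} [Field F]

theorem coeff_eval_T (P : Polynomial F[T;T⁻¹]) (δ i : ℤ) :
    (P.eval (T δ)).coeff i =
      ∑ j ∈ Finset.range (P.natDegree + 1), (P.coeff j).coeff (i - j * δ) := by
  rw [Polynomial.eval_eq_sum_range]
  simp only [T_pow, AddMonoidAlgebra.coeff_sum, Finsupp.finsetSum_apply, coeff_mul_T]

/-- Substituting `T δ` with `δ > 2 * D` places the coefficients of `P` in disjoint blocks. -/
theorem coeff_eval_T_add {P : Polynomial F[T;T⁻¹]} {D : ℤ}
    (hP : ∀ j, SupportedIn (-D) D (P.coeff j)) {δ : ℤ} (hδ : 2 * D < δ) {i : ℤ}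
    (hi : -D ≤ i ∧ i ≤ D) (j : ℕ) :
    (P.eval (T δ)).coeff (i + j * δ) = (P.coeff j).coeff i := by
  rw [coeff_eval_T, Finset.sum_eq_single j]
  · congr 1
    ring
  · intro k _ hk
    by_contra h
    have h1 := hP k _ h
    rcases lt_or_gt_of_ne hk with hlt | hlt
    · have : (k : ℤ) + 1 ≤ j := by exact_mod_cast hlt
      nlinarith
    · have : (j : ℤ) + 1 ≤ k := by exact_mod_cast hlt
      nlinarith
  · intro hj
    have : P.coeff j = 0 := Polynomial.coeff_eq_zero_of_natDegree_lt (by simpa using hj)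
    simp [this]

theorem eval_T_ne_zero {P : Polynomial F[T;T⁻¹]} {D : ℤ}
    (hP : ∀ j, SupportedIn (-D) D (P.coeff j)) {δ : ℤ} (hδ : 2 * D < δ) (h0 : P ≠ 0) :
    P.eval (T δ) ≠ 0 := by
  intro h
  obtain ⟨i, hi⟩ := exists_coeff_ne_zero (Polynomial.leadingCoeff_ne_zero.2 h0)
  refine hi ?_
  rw [Polynomial.leadingCoeff, ← coeff_eval_T_add hP hδ (hP _ i hi), h]
  simp

theorem supportedIn_eval_T {P : Polynomial F[T;T⁻¹]} {D : ℤ}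
    (hP : ∀ j, SupportedIn (-D) D (P.coeff j)) {d : ℕ} (hd : P.natDegree ≤ d) {δ : ℤ}
    (hδ : 0 ≤ δ) : SupportedIn (-D) (D + d * δ) (P.eval (T δ)) := by
  rw [Polynomial.eval_eq_sum_range]
  refine SupportedIn.sum _ fun j hj => ?_
  rw [T_pow]
  have hj' : (j : ℤ) ≤ d := by
    have := Finset.mem_range.1 hj
    omega
  have : (j : ℤ) * δ ≤ d * δ := mul_le_mul_of_nonneg_right hj' hδ
  have : 0 ≤ (j : ℤ) * δ := by positivity
  exact ((hP j).mul (supportedIn_T _)).mono (by omega) (by omega)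

theorem supportedIn_eval_T_natAbs {P : Polynomial F[T;T⁻¹]} {D : ℤ}
    (hP : ∀ j, SupportedIn (-D) D (P.coeff j)) {d : ℕ} (hd : P.natDegree ≤ d) {δ : ℤ} {M : ℕ}
    (hδ : δ.natAbs ≤ M) : SupportedIn (-(D + d * M)) (D + d * M) (P.eval (T δ)) := by
  rw [Polynomial.eval_eq_sum_range]
  refine SupportedIn.sum _ fun j hj => ?_
  rw [T_pow]
  have hj' : j ≤ d := by
    have := Finset.mem_range.1 hj
    omega
  have h : |(j : ℤ) * δ| ≤ d * M := by
    rw [abs_mul, Nat.abs_cast, Int.abs_eq_natAbs]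
    exact_mod_cast Nat.mul_le_mul hj' hδ
  have := abs_le.1 h
  exact ((hP j).mul (supportedIn_T _)).mono (by omega) (by omega)

theorem coeff_C_mul_supportedIn {P : Polynomial F[T;T⁻¹]} {c : F[T;T⁻¹]} {D E : ℤ}
    (hc : SupportedIn (-D) D c) (hP : ∀ j, SupportedIn (-E) E (P.coeff j)) (j : ℕ) :
    SupportedIn (-(E + D)) (E + D) ((Polynomial.C c * P).coeff j) := by
  rw [Polynomial.coeff_C_mul]
  exact (hc.mul (hP j)).mono (by omega) (by omega)

/-- Pseudo-division in `F[T;T⁻¹][X]`, with control of the exponents occurring in the remainder. -/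
theorem exists_pseudo_div {P : Polynomial F[T;T⁻¹]} {D : ℕ}
    (hP : ∀ j, SupportedIn (-(D : ℤ)) D (P.coeff j)) (h0 : P ≠ 0) (k : ℕ) :
    ∀ (Q : Polynomial F[T;T⁻¹]) (E : ℕ), Q.degree < k →
      (∀ j, SupportedIn (-(E : ℤ)) E (Q.coeff j)) →
      ∃ S R : Polynomial F[T;T⁻¹], Polynomial.C (P.leadingCoeff ^ k) * Q = P * S + R ∧
        R.degree < P.degree ∧
        ∀ j, SupportedIn (-((E + k * D : ℕ) : ℤ)) (E + k * D : ℕ) (R.coeff j) := by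
  induction k with
  | zero =>
    intro Q E hQ _
    have : Q = 0 := by
      rw [← Polynomial.degree_eq_bot]
      simpa using hQ
    refine ⟨0, 0, by simp [this], ?_, fun j => by simpa using supportedIn_zero _ _⟩
    rwa [Polynomial.degree_zero, bot_lt_iff_ne_bot, Ne, Polynomial.degree_eq_bot]
  | succ k ih =>
    intro Q E hQ hE
    by_cases hk : P.natDegree ≤ k
    · have hlead : ∀ j, SupportedIn (-((E + D : ℕ) : ℤ)) (E + D : ℕ)
          ((Polynomial.C P.leadingCoeff * Q -
            Polynomial.C (Q.coeff k) * (Polynomial.X ^ (k - P.natDegree) * P)).coeff j) := by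
        intro j
        rw [Polynomial.coeff_sub]
        push_cast
        refine (coeff_C_mul_supportedIn (hP _) hE j).sub ?_
        refine (coeff_C_mul_supportedIn (hE k) (E := D) (fun i => ?_) j).mono
          (by omega) (by omega)
        rw [Polynomial.coeff_X_pow_mul']
        split_ifs
        · exact hP _
        · exact supportedIn_zero _ _
      have hdeg : (Polynomial.C P.leadingCoeff * Q -
          Polynomial.C (Q.coeff k) * (Polynomial.X ^ (k - P.natDegree) * P)).degree <
            (k : WithBot ℕ) := by
        rw [Polynomial.degree_lt_iff_coeff_zero]
        intro m hm
        rw [Polynomial.coeff_sub, Polynomial.coeff_C_mul, Polynomial.coeff_C_mul]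
        rcases hm.eq_or_lt with rfl | hm
        · have : (Polynomial.X ^ (k - P.natDegree) * P).coeff k = P.leadingCoeff := by
            rw [Polynomial.coeff_X_pow_mul', if_pos (by omega), Polynomial.leadingCoeff]
            congr 1
            omega
          rw [this, mul_comm, sub_self]
        · have h1 : Q.coeff m = 0 := by
            rw [Polynomial.degree_lt_iff_coeff_zero] at hQ
            exact hQ m hm
          have h2 : (Polynomial.X ^ (k - P.natDegree) * P).coeff m = 0 := by
            rw [Polynomial.coeff_X_pow_mul', if_pos (by omega)]
            exact Polynomial.coeff_eq_zero_of_natDegree_lt (by omega)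
          rw [h1, h2, mul_zero, mul_zero, sub_self]
      obtain ⟨S, R, h, hR, hb⟩ := ih _ _ hdeg hlead
      refine ⟨S + Polynomial.C (P.leadingCoeff ^ k * Q.coeff k) *
        Polynomial.X ^ (k - P.natDegree), R, ?_, hR, ?_⟩
      · rw [mul_sub] at h
        rw [pow_succ, Polynomial.C_mul, Polynomial.C_mul]
        linear_combination h
      · intro j
        refine (hb j).mono ?_ ?_ <;> push_cast <;> linarith
    · refine ⟨0, Polynomial.C (P.leadingCoeff ^ (k + 1)) * Q, by simp, ?_, ?_⟩
      · rw [Polynomial.degree_C_mul (pow_ne_zero _ (Polynomial.leadingCoeff_ne_zero.2 h0))]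
        refine hQ.trans_le ?_
        rw [Polynomial.degree_eq_natDegree h0]
        exact_mod_cast not_le.1 hk
      · intro j
        push_cast
        exact_mod_cast coeff_C_mul_supportedIn ((hP _).pow (k + 1)) hE j

/-- A parameter bound for `exists_dvd_eval_T_le`, in terms of the degree in `X`, the exponents
of the coefficients and the number of elements of the field: from
`2 * (D + (m + 1) * D) + 2 * D` on, divisibility forces the pseudo-remainder to vanish, and
`q ^ (2 * ((m + 1) * D))` bounds the order of `T` modulo the power of the leading coefficient. -/
def dvdBound (q m D : ℕ) : ℕ :=
  2 * (D + (m + 1) * D) + 2 * D + q ^ (2 * ((m + 1) * D))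

/-- For large `δ`, a nonzero `R` of smaller degree than `P` is not divisible by `P` at `X = T δ`:
its specialization is narrower than that of `P`. Applied to pseudo-remainders. -/
theorem pseudo_rem_eq_zero {P R : Polynomial F[T;T⁻¹]} {D E : ℕ}
    (hP : ∀ j, SupportedIn (-(D : ℤ)) D (P.coeff j))
    (hR : ∀ j, SupportedIn (-(E : ℤ)) E (R.coeff j)) (hdeg : R.degree < P.degree)
    (h0 : P.coeff 0 ≠ 0) {δ : ℤ} (hδ : 2 * (E : ℤ) + 2 * D < δ)
    (h : P.eval (T δ) ∣ R.eval (T δ)) : R = 0 := by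
  by_contra hR0
  have hP0 : P ≠ 0 := by
    rintro rfl
    simp at h0
  obtain ⟨g, hg⟩ := h
  have hRδ := eval_T_ne_zero hR (by omega) hR0 (δ := δ)
  have hg0 : g ≠ 0 := by
    rintro rfl
    exact hRδ (by rw [hg, mul_zero])
  obtain ⟨i, hi⟩ := exists_coeff_ne_zero h0
  obtain ⟨j, hj⟩ := exists_coeff_ne_zero (Polynomial.leadingCoeff_ne_zero.2 hP0)
  have hi' := hP _ i hi
  have hj' := hP _ j hj
  rw [← coeff_eval_T_add hP (by omega) hi' (δ := δ)] at hi
  rw [Polynomial.leadingCoeff, ← coeff_eval_T_add hP (by omega) hj' (δ := δ)] at hj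
  have hnat := Polynomial.natDegree_lt_natDegree hR0 hdeg
  have hs := supportedIn_eval_T hR (Nat.le_sub_one_of_lt hnat) (δ := δ) (by omega)
  rw [hg] at hs
  have := sub_le_of_mul_supportedIn hi hj hg0 hs
  rw [Nat.cast_sub (by omega)] at this
  push_cast at this
  nlinarith

/-- The case of `exists_dvd_eval_T_le` where `P` is not divisible by `X`. -/
theorem exists_dvd_eval_T_le_of_coeff_zero_ne_zero [Fintype F] {P Q : Polynomial F[T;T⁻¹]}
    {m D : ℕ} (hP : ∀ j, SupportedIn (-(D : ℤ)) D (P.coeff j))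
    (hQ : ∀ j, SupportedIn (-(D : ℤ)) D (Q.coeff j)) (hm : Q.natDegree ≤ m)
    (h0 : P.coeff 0 ≠ 0) (δ : ℕ) (h : P.eval (T (δ : ℤ)) ∣ Q.eval (T (δ : ℤ))) :
    ∃ δ' ≤ dvdBound (Fintype.card F) m D, P.eval (T (δ' : ℤ)) ∣ Q.eval (T (δ' : ℤ)) := by
  have hP0 : P ≠ 0 := by
    rintro rfl
    simp at h0
  induction δ using Nat.strong_induction_on with
  | _ δ ih =>
    by_cases hle : δ ≤ dvdBound (Fintype.card F) m D
    · exact ⟨δ, hle, h⟩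
    -- A larger solution `δ` can be lowered by a period `N` of `T` modulo the power of the leading
    -- coefficient.
    obtain ⟨S, R, hSR, hR, hRb⟩ := exists_pseudo_div hP hP0 (m + 1) Q D
      ((Polynomial.degree_le_of_natDegree_le hm).trans_lt
        (by exact_mod_cast Nat.lt_succ_self m)) hQ
    have hc0 : P.leadingCoeff ^ (m + 1) ≠ 0 := pow_ne_zero _ (Polynomial.leadingCoeff_ne_zero.2 hP0)
    have hev : ∀ n : ℤ, P.leadingCoeff ^ (m + 1) * Q.eval (T n) =
        P.eval (T n) * S.eval (T n) + R.eval (T n) := fun n => by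
      simpa using congrArg (Polynomial.eval (T n)) hSR
    obtain ⟨N, hN0, hN, hdvd⟩ := exists_dvd_T_sub_one (E := (m + 1) * D) hc0
      (by exact_mod_cast (hP _).pow (m + 1))
    unfold dvdBound at hle
    have hR0 : R = 0 := by
      refine pseudo_rem_eq_zero hP hRb hR h0 (δ := δ) (by omega) ?_
      have h1 := (h.mul_left (P.leadingCoeff ^ (m + 1)))
      rw [hev] at h1
      exact (dvd_add_right (dvd_mul_right _ _)).1 h1
    simp only [hR0, Polynomial.eval_zero, add_zero] at hev
    have hPδ : P.eval (T (δ : ℤ)) ≠ 0 := eval_T_ne_zero hP (by omega) hP0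
    obtain ⟨g, hg⟩ := h
    -- Divisibility at `δ` now says that the power of the leading coefficient divides `S`.
    have hS : P.leadingCoeff ^ (m + 1) ∣ S.eval (T (δ : ℤ)) := by
      refine ⟨g, mul_left_cancel₀ hPδ ?_⟩
      rw [← hev, hg]
      ring
    have hTT : P.leadingCoeff ^ (m + 1) ∣ T (δ : ℤ) - T ((δ - N : ℕ) : ℤ) := by
      have : (T (δ : ℤ) - T ((δ - N : ℕ) : ℤ) : F[T;T⁻¹]) =
          (T (N : ℤ) - 1) * T ((δ - N : ℕ) : ℤ) := by
        rw [sub_mul, ← T_add, one_mul]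
        congr 2
        omega
      rw [this]
      exact hdvd.mul_right _
    have hS' : P.leadingCoeff ^ (m + 1) ∣ S.eval (T ((δ - N : ℕ) : ℤ)) :=
      (dvd_iff_dvd_of_dvd_sub (hTT.trans (Polynomial.sub_dvd_eval_sub _ _ S))).1 hS
    refine ih (δ - N) (by omega) ?_
    obtain ⟨g', hg'⟩ := hS'
    refine ⟨g', mul_left_cancel₀ hc0 ?_⟩
    rw [hev, hg']
    ring

/-- If `P(T δ)` divides `Q(T δ)` for some `δ ≥ 0`, then this happens for a small `δ`. -/
theorem exists_dvd_eval_T_le [Fintype F] {P Q : Polynomial F[T;T⁻¹]} {m D : ℕ}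
    (hP : ∀ j, SupportedIn (-(D : ℤ)) D (P.coeff j))
    (hQ : ∀ j, SupportedIn (-(D : ℤ)) D (Q.coeff j)) (hm : Q.natDegree ≤ m)
    (δ : ℕ) (h : P.eval (T (δ : ℤ)) ∣ Q.eval (T (δ : ℤ))) :
    ∃ δ' ≤ dvdBound (Fintype.card F) m D, P.eval (T (δ' : ℤ)) ∣ Q.eval (T (δ' : ℤ)) := by
  by_cases hP0 : P = 0
  · subst hP0
    by_cases hle : δ ≤ dvdBound (Fintype.card F) m D
    · exact ⟨δ, hle, h⟩
    · unfold dvdBound at hle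
      -- `Q(T δ) = 0` with `δ` large forces `Q = 0`, so that every parameter is a solution.
      have hQ0 : Q = 0 := by
        by_contra hQ0
        refine eval_T_ne_zero hQ (δ := δ) (by omega) hQ0 ?_
        simpa using h
      exact ⟨0, Nat.zero_le _, by simp [hQ0]⟩
  · obtain ⟨P', hPP', hX⟩ := Polynomial.exists_eq_pow_rootMultiplicity_mul_and_not_dvd P hP0 0
    rw [map_zero, sub_zero] at hPP' hX
    set l := P.rootMultiplicity 0
    have hcoeff : ∀ j, P'.coeff j = P.coeff (j + l) := fun j => by
      rw [hPP', Polynomial.coeff_X_pow_mul]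
    have hev : ∀ n : ℤ, P.eval (T n) ∣ Q.eval (T n) ↔ P'.eval (T n) ∣ Q.eval (T n) := fun n => by
      rw [hPP', Polynomial.eval_mul, Polynomial.eval_pow, Polynomial.eval_X]
      exact ((isUnit_T n).pow l).mul_left_dvd
    simp only [hev] at h ⊢
    exact exists_dvd_eval_T_le_of_coeff_zero_ne_zero (fun j => by rw [hcoeff]; exact hP _) hQ hm
      (fun h0 => hX (Polynomial.X_dvd_iff.2 h0)) δ h

theorem invert_eval_T (P : Polynomial F[T;T⁻¹]) (δ : ℤ) :
    invert (P.eval (T δ)) = (P.map (invert : F[T;T⁻¹] ≃ₐ[F] F[T;T⁻¹]).toRingHom).eval (T (-δ)) := by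
  rw [← invert_T, Polynomial.eval_map]
  exact Polynomial.hom_eval₂ P (RingHom.id _) (invert : F[T;T⁻¹] ≃ₐ[F] F[T;T⁻¹]).toRingHom (T δ)

/-- If `P(T δ)` divides `Q(T δ)` for some integer `δ`, then this happens for a small `δ`.
Negative `δ` are reduced to positive ones by the automorphism `T ↦ T⁻¹`. -/
theorem exists_dvd_eval_T_natAbs_le [Fintype F] {P Q : Polynomial F[T;T⁻¹]} {m D : ℕ}
    (hP : ∀ j, SupportedIn (-(D : ℤ)) D (P.coeff j))
    (hQ : ∀ j, SupportedIn (-(D : ℤ)) D (Q.coeff j)) (hm : Q.natDegree ≤ m)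
    (δ : ℤ) (h : P.eval (T δ) ∣ Q.eval (T δ)) :
    ∃ δ' : ℤ, δ'.natAbs ≤ dvdBound (Fintype.card F) m D ∧ P.eval (T δ') ∣ Q.eval (T δ') := by
  have hinv : ∀ n : ℤ, P.eval (T n) ∣ Q.eval (T n) ↔
      (P.map (invert : F[T;T⁻¹] ≃ₐ[F] F[T;T⁻¹]).toRingHom).eval (T (-n)) ∣
        (Q.map (invert : F[T;T⁻¹] ≃ₐ[F] F[T;T⁻¹]).toRingHom).eval (T (-n)) := fun n => by
    rw [← invert_eval_T, ← invert_eval_T]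
    exact (map_dvd_iff (invert : F[T;T⁻¹] ≃ₐ[F] F[T;T⁻¹])).symm
  obtain ⟨n, rfl | rfl⟩ := δ.eq_nat_or_neg
  · obtain ⟨δ', h1, h2⟩ := exists_dvd_eval_T_le hP hQ hm n h
    exact ⟨δ', by simpa using h1, h2⟩
  · rw [hinv, neg_neg] at h
    obtain ⟨δ', h1, h2⟩ := exists_dvd_eval_T_le (m := m) (D := D)
      (fun j => by rw [Polynomial.coeff_map]; exact (hP j).invert)
      (fun j => by rw [Polynomial.coeff_map]; exact (hQ j).invert)
      (Polynomial.natDegree_map_le.trans hm) n h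
    refine ⟨-δ', by simpa using h1, ?_⟩
    rwa [hinv, neg_neg]

end Specialization

end LaurentPolynomial

/-! ### Words as maps on the lamplighter group -/

namespace Lamplighter

open LaurentPolynomial

/-- The map `φ` of the lamplighter group is of the shape of the evaluation map of a word of length
`n` in `a`, `t`, `x`: at `x = (δ, f)` its position is `τ + σ * δ`, and, up to the unit `T (n * δ)`,
its lamps are `P(T δ) * f + Q(T δ)`, with bounds in `n` on `τ`, `σ`, the degrees of `P`, `Q`
and the exponents in their coefficients. The factor `T (n * δ)` makes all powers of `T δ`
nonnegative, so that `P` and `Q` can be ordinary polynomials over the Laurent polynomials. -/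
structure IsWordMap (n : ℕ) (τ σ : ℤ) (P Q : Polynomial ((ZMod 2)[T;T⁻¹]))
    (φ : Lamplighter → Lamplighter) : Prop where
  pos_eq : ∀ g, (φ g).pos = τ + σ * g.pos
  lamps_eq : ∀ g, (φ g).lamps * T (n * g.pos) = P.eval (T g.pos) * g.lamps + Q.eval (T g.pos)
  abs_tau_le : |τ| ≤ n
  abs_sigma_le : |σ| ≤ n
  natDegree_left : P.natDegree ≤ 2 * n
  natDegree_right : Q.natDegree ≤ 2 * n
  supported_left : ∀ j, SupportedIn (-(n : ℤ)) n (P.coeff j)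
  supported_right : ∀ j, SupportedIn (-(n : ℤ)) n (Q.coeff j)

theorem supportedIn_coeff_twist_add {n n' k l : ℕ} {τ : ℤ} (hτ : |τ| ≤ n')
    {A B : Polynomial ((ZMod 2)[T;T⁻¹])} (hA : ∀ j, SupportedIn (-(n : ℤ)) n (A.coeff j))
    (hB : ∀ j, SupportedIn (-(n' : ℤ)) n' (B.coeff j)) (j : ℕ) :
    SupportedIn (-((n + n' : ℕ) : ℤ)) (n + n' : ℕ)
      ((A * Polynomial.C (T (-τ)) * Polynomial.X ^ k + B * Polynomial.X ^ l).coeff j) := by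
  have := abs_le.1 hτ
  rw [Polynomial.coeff_add, Polynomial.coeff_mul_X_pow', Polynomial.coeff_mul_X_pow',
    Polynomial.coeff_mul_C]
  push_cast
  refine SupportedIn.add ?_ ?_
  · split_ifs
    · exact ((hA _).mul (supportedIn_T _)).mono (by omega) (by omega)
    · exact supportedIn_zero _ _
  · split_ifs
    · exact (hB _).mono (by omega) (by omega)
    · exact supportedIn_zero _ _

theorem natDegree_twist_add_le {n n' k : ℕ} (hk : k ≤ 2 * n') {c : (ZMod 2)[T;T⁻¹]}
    {A B : Polynomial ((ZMod 2)[T;T⁻¹])} (hA : A.natDegree ≤ 2 * n)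
    (hB : B.natDegree ≤ 2 * n') :
    (A * Polynomial.C c * Polynomial.X ^ k + B * Polynomial.X ^ n).natDegree ≤ 2 * (n + n') := by
  refine Polynomial.natDegree_add_le_of_degree_le ?_ ?_
  · refine Polynomial.natDegree_mul_le.trans ?_
    rw [Polynomial.natDegree_X_pow]
    have := (Polynomial.natDegree_mul_C_le A c)
    omega
  · refine Polynomial.natDegree_mul_le.trans ?_
    rw [Polynomial.natDegree_X_pow]
    omega

/-- In a product `φ g * ψ g` the lamps of `φ g` are translated by the position `τ' + σ' * δ` of
`ψ g`; this is where the parameter `δ` enters the exponents. -/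
theorem IsWordMap.mul {n n' : ℕ} {τ τ' σ σ' : ℤ} {P Q P' Q' : Polynomial ((ZMod 2)[T;T⁻¹])}
    {φ ψ : Lamplighter → Lamplighter} (h : IsWordMap n τ σ P Q φ)
    (h' : IsWordMap n' τ' σ' P' Q' ψ) :
    IsWordMap (n + n') (τ + τ') (σ + σ')
      (P * Polynomial.C (T (-τ')) * Polynomial.X ^ (n' - σ').toNat + P' * Polynomial.X ^ n)
      (Q * Polynomial.C (T (-τ')) * Polynomial.X ^ (n' - σ').toNat + Q' * Polynomial.X ^ n)
      (fun g => φ g * ψ g) where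
  pos_eq g := by
    simp only [mul_def, h.pos_eq, h'.pos_eq]
    ring
  lamps_eq g := by
    have hσ := abs_le.1 h'.abs_sigma_le
    simp only [mul_def, h'.pos_eq, Polynomial.eval_add, Polynomial.eval_mul, Polynomial.eval_C,
      Polynomial.eval_pow, Polynomial.eval_X, T_pow]
    rw [Int.toNat_of_nonneg (by omega)]
    have e1 : (T (-(τ' + σ' * g.pos)) * T (((n + n' : ℕ) : ℤ) * g.pos) : (ZMod 2)[T;T⁻¹]) =
        T (n * g.pos) * (T (-τ') * T ((n' - σ') * g.pos)) := by
      simp only [← T_add]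
      congr 1
      push_cast
      ring
    have e2 : (T (((n + n' : ℕ) : ℤ) * g.pos) : (ZMod 2)[T;T⁻¹]) =
        T (n' * g.pos) * T (n * g.pos) := by
      simp only [← T_add]
      congr 1
      push_cast
      ring
    rw [add_mul, mul_assoc, e1, e2, ← mul_assoc, h.lamps_eq, ← mul_assoc (ψ g).lamps, h'.lamps_eq]
    ring
  abs_tau_le := by
    push_cast
    exact (abs_add_le _ _).trans (add_le_add h.abs_tau_le h'.abs_tau_le)
  abs_sigma_le := by
    push_cast
    exact (abs_add_le _ _).trans (add_le_add h.abs_sigma_le h'.abs_sigma_le)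
  natDegree_left := by
    have hσ := abs_le.1 h'.abs_sigma_le
    exact natDegree_twist_add_le (by omega) h.natDegree_left h'.natDegree_left
  natDegree_right := by
    have hσ := abs_le.1 h'.abs_sigma_le
    exact natDegree_twist_add_le (by omega) h.natDegree_right h'.natDegree_right
  supported_left := supportedIn_coeff_twist_add h'.abs_tau_le h.supported_left h'.supported_left
  supported_right :=
    supportedIn_coeff_twist_add h'.abs_tau_le h.supported_right h'.supported_right

theorem isWordMap_one : IsWordMap 0 0 0 0 0 (fun _ => 1) where
  pos_eq g := by simp [one_def]
  lamps_eq g := by simp [one_def]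
  abs_tau_le := by simp
  abs_sigma_le := by simp
  natDegree_left := by simp
  natDegree_right := by simp
  supported_left j := by simpa using supportedIn_zero _ _
  supported_right j := by simpa using supportedIn_zero _ _

/-- The value of a letter `a^±`, `t^±` or `x^±` at `x = g`. -/
noncomputable def letterVal (l : Fin 3 × Bool) (g : Lamplighter) : Lamplighter :=
  cond l.2 (![a, t, g] l.1) (![a, t, g] l.1)⁻¹

theorem evalAt_nil (g : Lamplighter) : evalAt [] g = 1 := by
  simp [evalAt]

theorem evalAt_cons (l : Fin 3 × Bool) (w : Word) (g : Lamplighter) :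
    evalAt (l :: w) g = letterVal l g * evalAt w g := by
  simp [evalAt, letterVal, FreeGroup.lift_mk]

theorem supportedIn_coeff_X_pow (k j : ℕ) :
    SupportedIn (-((1 : ℕ) : ℤ)) (1 : ℕ)
      ((Polynomial.X ^ k : Polynomial ((ZMod 2)[T;T⁻¹])).coeff j) := by
  rw [Polynomial.coeff_X_pow]
  split_ifs
  · exact supportedIn_one.mono (by simp) (by simp)
  · exact supportedIn_zero _ _

theorem neg_eq_self (f : (ZMod 2)[T;T⁻¹]) : -f = f := by
  ext i
  simp

theorem lamps_inv (g : Lamplighter) : g⁻¹.lamps = g.lamps * T g.pos := by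
  rw [inv_def, neg_eq_self]

theorem exists_isWordMap_letterVal (l : Fin 3 × Bool) :
    ∃ τ σ P Q, IsWordMap 1 τ σ P Q (letterVal l) := by
  have hX := supportedIn_coeff_X_pow 1
  have hX2 := supportedIn_coeff_X_pow 2
  have h0 : ∀ j, SupportedIn (-((1 : ℕ) : ℤ)) (1 : ℕ)
      ((0 : Polynomial ((ZMod 2)[T;T⁻¹])).coeff j) := fun j => by
    rw [Polynomial.coeff_zero]
    exact supportedIn_zero _ _
  obtain ⟨i, b⟩ := l
  fin_cases i <;> cases b
  · exact ⟨0, 0, 0, Polynomial.X ^ 1, by simp [letterVal, a, inv_def],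
      fun g => by simp [letterVal, a, lamps_inv], by simp, by simp, by simp, by simp, h0, hX⟩
  · exact ⟨0, 0, 0, Polynomial.X ^ 1, by simp [letterVal, a], fun g => by simp [letterVal, a],
      by simp, by simp, by simp, by simp, h0, hX⟩
  · exact ⟨-1, 0, 0, 0, by simp [letterVal, t, inv_def],
      fun g => by simp [letterVal, t, lamps_inv], by simp, by simp, by simp, by simp, h0, h0⟩
  · exact ⟨1, 0, 0, 0, by simp [letterVal, t], fun g => by simp [letterVal, t],
      by simp, by simp, by simp, by simp, h0, h0⟩
  · exact ⟨0, -1, Polynomial.X ^ 2, 0, by simp [letterVal, inv_def],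
      fun g => by
        have : g.lamps * T g.pos * T g.pos = T g.pos ^ 2 * g.lamps := by ring
        simpa [letterVal, lamps_inv] using this, by simp, by simp, by simp, by simp, hX2, h0⟩
  · exact ⟨0, 1, Polynomial.X ^ 1, 0, by simp [letterVal],
      fun g => by simp [letterVal, mul_comm], by simp, by simp, by simp, by simp, hX, h0⟩

theorem exists_isWordMap_evalAt (w : Word) :
    ∃ τ σ P Q, IsWordMap w.length τ σ P Q (evalAt w) := by
  induction w with
  | nil =>
    rw [show evalAt [] = fun _ => 1 from funext evalAt_nil]
    exact ⟨0, 0, 0, 0, isWordMap_one⟩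
  | cons l w ih =>
    obtain ⟨τ', σ', P', Q', h'⟩ := ih
    obtain ⟨τ, σ, P, Q, h⟩ := exists_isWordMap_letterVal l
    have := h.mul h'
    simp only [← evalAt_cons] at this
    rw [List.length_cons, add_comm]
    exact ⟨_, _, _, _, this⟩

theorem IsWordMap.eq_one_iff {n : ℕ} {τ σ : ℤ} {P Q : Polynomial ((ZMod 2)[T;T⁻¹])}
    {φ : Lamplighter → Lamplighter} (h : IsWordMap n τ σ P Q φ) (g : Lamplighter) :
    φ g = 1 ↔ τ + σ * g.pos = 0 ∧ P.eval (T g.pos) * g.lamps + Q.eval (T g.pos) = 0 := by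
  rw [← h.pos_eq, ← h.lamps_eq, (isUnit_T _).mul_left_eq_zero, Lamplighter.ext_iff]
  rfl

/-! ### Bounded solutions -/

/-- A bound for the position of a smallest solution of an equation of length `n`. -/
def posBound (n : ℕ) : ℕ := n + dvdBound 2 (2 * n) n

/-- A bound for the lamps lit in a smallest solution of an equation of length `n`. -/
def lampBound (n : ℕ) : ℕ := 2 * (n + 2 * n * posBound n)

/-- An equation with a solution has a solution of bounded size. If the exponent sum of `x` is
nonzero, the position is determined by the equation; otherwise it is a free parameter `δ`,
and the equation in the lamps is solvable at `δ` when `P(T δ)` divides `Q(T δ)`. -/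
theorem exists_bounded_solution {w : Word} (hw : HasSolution w) :
    ∃ g : Lamplighter, evalAt w g = 1 ∧ g.pos.natAbs ≤ posBound w.length ∧
      SupportedIn (-(lampBound w.length : ℤ)) (lampBound w.length) g.lamps := by
  obtain ⟨τ, σ, P, Q, h⟩ := exists_isWordMap_evalAt w
  set n := w.length
  obtain ⟨g, hg⟩ := hw
  obtain ⟨hpos, hlamps⟩ := (h.eq_one_iff g).1 hg
  have hdvd : P.eval (T g.pos) ∣ Q.eval (T g.pos) := by
    refine ⟨-g.lamps, ?_⟩
    linear_combination hlamps
  obtain ⟨δ, hδ, hδ0, hδdvd⟩ : ∃ δ : ℤ, δ.natAbs ≤ posBound n ∧ τ + σ * δ = 0 ∧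
      P.eval (T δ) ∣ Q.eval (T δ) := by
    by_cases hσ : σ = 0
    · obtain ⟨δ, h1, h2⟩ := exists_dvd_eval_T_natAbs_le h.supported_left h.supported_right
        h.natDegree_right g.pos hdvd
      rw [ZMod.card] at h1
      refine ⟨δ, h1.trans (Nat.le_add_left _ _), ?_, h2⟩
      rw [hσ, zero_mul] at hpos ⊢
      exact hpos
    · refine ⟨g.pos, ?_, hpos, hdvd⟩
      have h1 : g.pos.natAbs ≤ τ.natAbs := by
        rw [show τ = -(σ * g.pos) by linarith, Int.natAbs_neg, Int.natAbs_mul]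
        exact Nat.le_mul_of_pos_left _ (Int.natAbs_pos.2 hσ)
      have h2 := h.abs_tau_le
      rw [Int.abs_eq_natAbs] at h2
      unfold posBound
      omega
  obtain ⟨f, hf⟩ := hδdvd
  by_cases hP : P.eval (T δ) = 0
  · refine ⟨⟨δ, 0⟩, (h.eq_one_iff _).2 ⟨hδ0, ?_⟩, hδ, supportedIn_zero _ _⟩
    simp [hf, hP]
  · refine ⟨⟨δ, -f⟩, (h.eq_one_iff _).2 ⟨hδ0, ?_⟩, hδ, SupportedIn.neg ?_⟩
    · rw [hf]
      ring
    · have hK := supportedIn_eval_T_natAbs h.supported_left h.natDegree_left hδ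
      have hK' := supportedIn_eval_T_natAbs h.supported_right h.natDegree_right hδ
      rw [hf] at hK'
      have := supportedIn_of_mul hP hK hK'
      unfold lampBound
      exact_mod_cast this

/-! ### Generation by `a` and `t` -/

theorem t_zpow (n : ℤ) : t ^ n = ⟨n, 0⟩ := by
  induction n using Int.induction_on with
  | zero => rfl
  | succ n ih => rw [zpow_add_one, ih, mul_def]; simp [t]
  | pred n ih => rw [zpow_sub_one, ih, mul_def, inv_def]; simp [t, sub_eq_add_neg]

theorem t_zpow_mul_a_mul (n : ℤ) : t ^ n * a * t ^ (-n) = ⟨0, T n⟩ := by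
  rw [zpow_neg]
  simp [t_zpow, mul_def, inv_def, a]

theorem mem_range_lift (f : (ZMod 2)[T;T⁻¹]) :
    (⟨0, f⟩ : Lamplighter) ∈ (FreeGroup.lift ![a, t]).range := by
  have ha : a ∈ (FreeGroup.lift ![a, t]).range := ⟨FreeGroup.of 0, by simp⟩
  have ht : t ∈ (FreeGroup.lift ![a, t]).range := ⟨FreeGroup.of 1, by simp⟩
  induction f using LaurentPolynomial.induction_on' with
  | add p q hp hq =>
    have := mul_mem hp hq
    rwa [show (⟨0, p⟩ * ⟨0, q⟩ : Lamplighter) = ⟨0, p + q⟩ by simp [mul_def]] at this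
  | C_mul_T n r =>
    obtain rfl | rfl : r = 0 ∨ r = 1 := by
      revert r
      decide
    · rw [map_zero, zero_mul]
      exact one_mem _
    · rw [map_one, one_mul, ← t_zpow_mul_a_mul]
      exact mul_mem (mul_mem (zpow_mem ht _) ha) (zpow_mem ht _)

/-- The elements `a` and `t` generate the lamplighter group. -/
theorem lift_surjective : Function.Surjective (FreeGroup.lift ![a, t]) := fun g => by
  have ht : t ∈ (FreeGroup.lift ![a, t]).range := ⟨FreeGroup.of 1, by simp⟩
  have := mul_mem (zpow_mem ht g.pos) (mem_range_lift g.lamps)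
  rw [t_zpow, mul_def] at this
  simpa using this

theorem dp1_iff_hasSolution (w : Word) : DP1 w ↔ HasSolution w := by
  constructor
  · rintro ⟨s, hs⟩
    exact ⟨_, hs⟩
  · rintro ⟨g, hg⟩
    obtain ⟨s, rfl⟩ := lift_surjective g
    exact ⟨s, hg⟩

end Lamplighter

/-! ### Computing with codes of group elements -/

namespace Lamplighter

open LaurentPolynomial

/-- A concrete representation of elements of the lamplighter group by natural numbers: a pair
`(p, q)` stands for the integer `p - q`; the first component is the position of the lamplighter,
the list contains the places where the lamp is switched, possibly with repetitions. -/
abbrev Code : Type := (ℕ × ℕ) × List (ℕ × ℕ)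

namespace Code

/-- The integer represented by a pair of natural numbers. -/
def intVal (e : ℕ × ℕ) : ℤ := e.1 - e.2

/-- The configuration of lamps represented by a list of switched places. -/
noncomputable def lampsVal (l : List (ℕ × ℕ)) : (ZMod 2)[T;T⁻¹] :=
  (l.map fun e => T (intVal e)).sum

/-- The group element represented by a code. -/
noncomputable def val (c : Code) : Lamplighter := ⟨intVal c.1, lampsVal c.2⟩

/-- Translation of switched places by `-(d.1 - d.2)`. -/
def shift (l : List (ℕ × ℕ)) (d : ℕ × ℕ) : List (ℕ × ℕ) :=
  l.map fun e => (e.1 + d.2, e.2 + d.1)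

/-- Multiplication on codes. -/
def mul (c d : Code) : Code :=
  ((c.1.1 + d.1.1, c.1.2 + d.1.2), shift c.2 d.1 ++ d.2)

/-- Inversion on codes. -/
def inv (c : Code) : Code :=
  ((c.1.2, c.1.1), shift c.2 (c.1.2, c.1.1))

theorem lampsVal_shift (l : List (ℕ × ℕ)) (d : ℕ × ℕ) :
    lampsVal (shift l d) = lampsVal l * T (-intVal d) := by
  induction l with
  | nil => simp [lampsVal, shift]
  | cons e l ih =>
    simp only [lampsVal, shift, List.map_cons, List.sum_cons, add_mul] at ih ⊢
    rw [ih, ← T_add]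
    congr 2
    simp only [intVal]
    push_cast
    ring

theorem val_mul (c d : Code) : val (mul c d) = val c * val d := by
  rw [mul_def]
  ext1
  · simp only [val, mul, intVal]
    push_cast
    ring
  · simp only [val, mul]
    rw [← lampsVal_shift]
    simp [lampsVal]

theorem val_inv (c : Code) : val (inv c) = (val c)⁻¹ := by
  ext1
  · simp [val, inv, intVal, inv_def]
  · rw [lamps_inv]
    simp only [val, inv]
    rw [lampsVal_shift]
    simp [intVal]

/-- The code of the value of a letter at `x = c`. -/
def letter (l : Fin 3 × Bool) (c : Code) : Code :=
  let g : Code := if l.1 = 0 then ((0, 0), [(0, 0)]) else if l.1 = 1 then ((1, 0), []) else c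
  cond l.2 g (inv g)

theorem val_letter (l : Fin 3 × Bool) (c : Code) : val (letter l c) = letterVal l (val c) := by
  have ha : val ((0, 0), [(0, 0)]) = a := by simp [val, intVal, lampsVal, a]
  have ht : val ((1, 0), []) = t := by simp [val, intVal, lampsVal, t]
  obtain ⟨i, b⟩ := l
  fin_cases i <;> cases b <;> simp [letter, letterVal, val_inv, ha, ht]

/-- The code of the value of a word at `x = c`. -/
def eval (w : Word) (c : Code) : Code :=
  w.foldr (fun l d => mul (letter l c) d) ((0, 0), [])

theorem val_eval (w : Word) (c : Code) : val (eval w c) = evalAt w (val c) := by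
  induction w with
  | nil =>
    rw [evalAt_nil]
    simp [eval, val, intVal, lampsVal, one_def]
  | cons l w ih =>
    rw [evalAt_cons, ← val_letter, ← ih, ← val_mul]
    rfl

/-- The pairs `e` and `e'` represent the same integer. -/
def SameInt (e e' : ℕ × ℕ) : Prop := e.1 + e'.2 = e'.1 + e.2

instance : DecidableRel SameInt := fun _ _ => inferInstanceAs (Decidable (_ = _))

theorem sameInt_iff (e e' : ℕ × ℕ) : SameInt e e' ↔ intVal e = intVal e' := by
  unfold SameInt intVal
  omega

/-- The code `c` represents the trivial element: the position is the origin, and every lamp is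
switched an even number of times. -/
def IsOne (c : Code) : Prop :=
  c.1.1 = c.1.2 ∧ ∀ e ∈ c.2, (c.2.filter fun e' => SameInt e' e).length % 2 = 0

theorem coeff_lampsVal (l : List (ℕ × ℕ)) (e : ℕ × ℕ) :
    (lampsVal l).coeff (intVal e) = ((l.filter fun e' => SameInt e' e).length : ZMod 2) := by
  induction l with
  | nil => simp [lampsVal]
  | cons d l ih =>
    have hc : lampsVal (d :: l) = T (intVal d) + lampsVal l := by simp [lampsVal]
    rw [hc, AddMonoidAlgebra.coeff_add, Finsupp.add_apply, ih, coeff_T, List.filter_cons]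
    by_cases h : SameInt d e
    · have h' := (sameInt_iff d e).1 h
      simp [h, h', add_comm]
    · have h' : intVal d ≠ intVal e := fun h' => h ((sameInt_iff d e).2 h')
      simp [h, h']

theorem coeff_lampsVal_eq_zero {l : List (ℕ × ℕ)} {i : ℤ} (h : ∀ e ∈ l, intVal e ≠ i) :
    (lampsVal l).coeff i = 0 := by
  induction l with
  | nil => simp [lampsVal]
  | cons d l ih =>
    have hc : lampsVal (d :: l) = T (intVal d) + lampsVal l := by simp [lampsVal]
    rw [hc, AddMonoidAlgebra.coeff_add, Finsupp.add_apply, coeff_T,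
      if_neg (h d List.mem_cons_self), ih fun e he => h e (List.mem_cons_of_mem _ he), add_zero]

theorem isOne_iff (c : Code) : IsOne c ↔ val c = 1 := by
  rw [Lamplighter.ext_iff]
  refine and_congr ?_ ?_
  · simp only [val, intVal, one_def]
    omega
  · simp only [val, one_def]
    constructor
    · intro h
      refine LaurentPolynomial.ext fun i => ?_
      by_cases hi : ∃ e ∈ c.2, intVal e = i
      · obtain ⟨e, he, rfl⟩ := hi
        rw [coeff_lampsVal, (ZMod.natCast_eq_zero_iff_even).2 (Nat.even_iff.2 (h e he))]
        simp
      · push Not at hi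
        rw [coeff_lampsVal_eq_zero hi]
        simp
    · intro h e _
      have := coeff_lampsVal c.2 e
      rw [h] at this
      exact Nat.even_iff.1 (ZMod.natCast_eq_zero_iff_even.1 (by simpa using this.symm))

/-! ### Search among finitely many candidates -/

/-- All sets of natural numbers less than `n`, as lists. -/
def subsets : ℕ → List (List ℕ)
  | 0 => [[]]
  | n + 1 => subsets n ++ (subsets n).map (List.cons n)

theorem exists_mem_subsets (K n : ℕ) :
    ∀ f : (ZMod 2)[T;T⁻¹], SupportedIn (-(K : ℤ)) (n - 1 - K) f →
      ∃ l ∈ subsets n, lampsVal (l.map fun i => (i, K)) = f := by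
  induction n with
  | zero =>
    intro f hf
    refine ⟨[], by simp [subsets], ?_⟩
    by_contra h
    obtain ⟨i, hi⟩ := exists_coeff_ne_zero (Ne.symm h)
    have := hf i hi
    push_cast at this
    omega
  | succ n ih =>
    intro f hf
    by_cases h : f.coeff (n - K) = 0
    · obtain ⟨l, hl, hlf⟩ := ih f fun i hi => by
        have := hf i hi
        have : i ≠ n - K := by
          rintro rfl
          exact hi h
        push_cast at *
        omega
      exact ⟨l, by simp [subsets, hl], hlf⟩
    · have h1 : f.coeff (n - K) = 1 := by
        have : ∀ r : ZMod 2, r ≠ 0 → r = 1 := by decide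
        exact this _ h
      obtain ⟨l, hl, hlf⟩ := ih (f - T (n - K)) fun i hi => by
        rw [AddMonoidAlgebra.coeff_sub, Finsupp.sub_apply, coeff_T] at hi
        have hne : (n : ℤ) - K ≠ i := by
          rintro rfl
          simp [h1] at hi
        rw [if_neg hne, sub_zero] at hi
        have := hf i hi
        push_cast at this
        omega
      refine ⟨n :: l, by simp [subsets, hl], ?_⟩
      have hc : lampsVal ((n :: l).map fun i => (i, K)) =
          T (n - K) + lampsVal (l.map fun i => (i, K)) := by simp [lampsVal, intVal]
      rw [hc, hlf, add_sub_cancel]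

/-- Codes for all group elements with position in `[-M, M]` and lamps lit in `[-K, K]`. -/
def candidates (M K : ℕ) : List Code :=
  (List.range (2 * M + 1)).flatMap fun p =>
    (subsets (2 * K + 1)).map fun l => ((p, M), l.map fun i => (i, K))

theorem exists_mem_candidates {M K : ℕ} {g : Lamplighter} (hM : g.pos.natAbs ≤ M)
    (hK : SupportedIn (-(K : ℤ)) K g.lamps) : ∃ c ∈ candidates M K, val c = g := by
  obtain ⟨l, hl, hlf⟩ := exists_mem_subsets K (2 * K + 1) g.lamps
    (hK.mono le_rfl (by push_cast; omega))
  refine ⟨(((g.pos + M).toNat, M), l.map fun i => (i, K)), ?_, ?_⟩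
  · simp only [candidates, List.mem_flatMap, List.mem_range, List.mem_map]
    exact ⟨_, by omega, l, hl, rfl⟩
  · ext1
    · simp only [val, intVal]
      omega
    · exact hlf

theorem hasSolution_iff (w : Word) :
    HasSolution w ↔
      ∃ c ∈ candidates (posBound w.length) (lampBound w.length), IsOne (eval w c) := by
  simp only [isOne_iff, val_eval]
  constructor
  · intro h
    obtain ⟨g, hg, hpos, hlamps⟩ := exists_bounded_solution h
    obtain ⟨c, hc, rfl⟩ := exists_mem_candidates hpos hlamps
    exact ⟨c, hc, hg⟩
  · rintro ⟨c, -, hc⟩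
    exact ⟨_, hc⟩

end Code

end Lamplighter

/-! ### The search is primitive recursive -/

namespace Lamplighter.Code

open Primrec

theorem primrec_shift : Primrec₂ shift := by
  refine list_map fst ?_
  exact Primrec.pair
    (nat_add.comp (fst.comp snd) (snd.comp (snd.comp fst)))
    (nat_add.comp (snd.comp snd) (fst.comp (snd.comp fst)))

theorem primrec_mul : Primrec₂ mul := by
  refine Primrec.pair (Primrec.pair ?_ ?_) ?_
  · exact nat_add.comp (fst.comp (fst.comp fst)) (fst.comp (fst.comp snd))
  · exact nat_add.comp (snd.comp (fst.comp fst)) (snd.comp (fst.comp snd))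
  · exact list_append.comp (primrec_shift.comp (snd.comp fst) (fst.comp snd)) (snd.comp snd)

theorem primrec_inv : Primrec inv := by
  have h : Primrec fun c : Code => (c.1.2, c.1.1) :=
    Primrec.pair (snd.comp fst) (fst.comp fst)
  exact Primrec.pair h (primrec_shift.comp snd h)

theorem primrec_letter : Primrec₂ letter := by
  have hg : Primrec fun p : (Fin 3 × Bool) × Code =>
      if p.1.1 = 0 then (((0, 0), [(0, 0)]) : Code)
      else if p.1.1 = 1 then ((1, 0), []) else p.2 :=
    Primrec.ite (Primrec.eq.comp (fst.comp fst) (const 0)) (const _)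
      (Primrec.ite (Primrec.eq.comp (fst.comp fst) (const 1)) (const _) snd)
  exact Primrec.cond (snd.comp fst) hg (primrec_inv.comp hg)

theorem primrec_eval : Primrec₂ eval := by
  refine list_foldr (h := fun (p : Word × Code) (q : (Fin 3 × Bool) × Code) =>
    mul (letter q.1 p.2) q.2) fst (const _) ?_
  exact primrec_mul.comp (primrec_letter.comp (fst.comp snd) (snd.comp fst)) (snd.comp snd)

theorem primrecRel_sameInt : PrimrecRel SameInt :=
  Primrec.eq.comp (nat_add.comp (fst.comp fst) (snd.comp snd))
    (nat_add.comp (fst.comp snd) (snd.comp fst))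

theorem primrecPred_isOne : PrimrecPred IsOne := by
  have h : PrimrecRel fun (e : ℕ × ℕ) (l : List (ℕ × ℕ)) =>
      (l.filter fun e' => SameInt e' e).length % 2 = 0 :=
    Primrec.eq.comp
      (nat_mod.comp (list_length.comp (primrecRel_sameInt.listFilter.comp snd fst)) (const 2))
      (const 0)
  exact PrimrecPred.and (Primrec.eq.comp (fst.comp fst) (snd.comp fst))
    (h.forall_mem_list.comp snd snd)

theorem primrec_subsets : Primrec subsets := by
  have h : Primrec₂ fun (n : ℕ) (L : List (List ℕ)) => L ++ L.map (List.cons n) :=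
    list_append.comp snd (list_map snd (list_cons.comp (fst.comp fst) snd))
  refine (nat_rec₁ [[]] h).of_eq fun n => ?_
  induction n with
  | zero => rfl
  | succ n ih => simp only [subsets, ← ih]

theorem primrec_candidates : Primrec₂ candidates := by
  refine list_flatMap
    (list_range.comp (Primrec.succ.comp (nat_mul.comp (const 2) fst))) ?_
  refine list_map (primrec_subsets.comp
    (Primrec.succ.comp (nat_mul.comp (const 2) (snd.comp fst)))) ?_
  exact Primrec.pair (Primrec.pair (snd.comp fst) (fst.comp (fst.comp fst)))
    (list_map snd (Primrec.pair snd (snd.comp (fst.comp (fst.comp fst)))))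

theorem primrec_two_pow : Primrec fun n : ℕ => 2 ^ n := by
  have h : Primrec₂ fun _ r : ℕ => r * 2 := nat_mul.comp snd (const 2)
  refine (nat_rec₁ 1 h).of_eq fun n => ?_
  induction n with
  | zero => rfl
  | succ n ih => rw [pow_succ, ← ih]

theorem primrec_posBound : Primrec posBound := by
  have h2 : Primrec fun n : ℕ => 2 * n := nat_mul.comp (const 2) .id
  have hD : Primrec fun n : ℕ => (2 * n + 1) * n := nat_mul.comp (Primrec.succ.comp h2) .id
  exact nat_add.comp .id (nat_add.comp
    (nat_add.comp (h2.comp (nat_add.comp .id hD)) h2) (primrec_two_pow.comp (h2.comp hD)))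

theorem primrec_lampBound : Primrec lampBound := by
  have h2 : Primrec fun n : ℕ => 2 * n := nat_mul.comp (const 2) .id
  exact h2.comp (nat_add.comp .id (nat_mul.comp h2 primrec_posBound))

/-- Solvability of one-variable equations over the lamplighter group is decided by testing the
finitely many group elements within the bounds. -/
theorem computablePred_hasSolution : ComputablePred HasSolution := by
  have h : PrimrecRel fun (c : Code) (w : Word) => IsOne (eval w c) :=
    primrecPred_isOne.comp (primrec_eval.comp .snd .fst)
  exact ((h.exists_mem_list.comp
    (primrec_candidates.comp (primrec_posBound.comp .list_length)
      (primrec_lampBound.comp .list_length)) .id).of_eq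
        fun w => (hasSolution_iff w).symm).computablePred

end Lamplighter.Code

/-- There is an algorithm that, given a word `w(a, t, x)` with `σ_x(w) = 0`, decides whether
`w(a, t, x) = 1` has a solution in the lamplighter group; and `DP₁(L₂)`, for arbitrary words
`w(a, t, x)`, is decidable. -/
theorem mainTheorem1 :
    (∃ alg : Word → Bool, Computable alg ∧
      ∀ w : Word, sigmaX w = 0 → (alg w = true ↔ HasSolution w)) ∧
    ComputablePred DP1 := by
  refine ⟨?_, Lamplighter.Code.computablePred_hasSolution.of_eq
    fun w => (Lamplighter.dp1_iff_hasSolution w).symm⟩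
  obtain ⟨alg, halg, h⟩ :=
    ComputablePred.computable_iff.1 Lamplighter.Code.computablePred_hasSolution
  exact ⟨alg, halg, fun w _ => by rw [h]⟩
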